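/- Theorem 1 (Sharp Ehrenfest theorem). Let $X$ be a complex Hilbert space with inner product $\langle\cdot,\cdot\rangle$, antilinear in the first argument. Let $H : D(H)\to X$ be a densely defined self-adjoint operator on $X$, and let $e^{-itH}$, $t\in\mathbb{R}$, denote the strongly continuous one-parameter unitary group with infinitesimal generator $-iH$. Let $A : D(A)\to X$ be a linear operator defined on a subspace $D(A)\subseteq X$ which is either densely defined and self-adjoint or, more generally, closed and hermitean (that is, $\langle A\psi,\varphi\rangle=\langle\psi,A\varphi\rangle$ for all $\psi,\varphi\in D(A)$) but not necessarily densely defined. Suppose that $e^{-itH}$ maps $D(A)\cap D(H)$ into itself for every $t\in\mathbb{R}$. Then for every $\psi_0\in D(A)\cap D(H)$, with $\psi(t):=e^{-itH}\psi_0$, the function $t\mapsto\langle\psi(t),A\psi(t)\rangle$ is continuously differentiable on $\mathbb{R}$, and for all $t\in\mathbb{R}$ $$\frac{d}{dt}\langle\psi(t),A\psi(t)\rangle = i\bigl(\langle H\psi(t),A\psi(t)\rangle-\langle A\psi(t),H\psi(t)\rangle\bigr).$$ -/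

import Mathlib

open Complex

noncomputable section

/-- A linear operator `A : D(A) → X`, not necessarily densely defined, is hermitean if
`⟪A ψ, φ⟫ = ⟪ψ, A φ⟫` for all `ψ, φ ∈ D(A)`. -/
def IsHermitean {X : Type*} [NormedAddCommGroup X] [InnerProductSpace ℂ X]
    (A : X →ₗ.[ℂ] X) : Prop :=
  ∀ ψ φ : A.domain, inner ℂ (A ψ) (φ : X) = inner ℂ (ψ : X) (A φ)

/-- `U` is a strongly continuous one-parameter unitary group on `X` whose infinitesimal generator
is `-iH`: the orbit of `ψ` is differentiable at `0` exactly if `ψ ∈ D(H)`, and then its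
derivative there is `-iHψ`. -/
structure IsUnitaryGroupGeneratedBy {X : Type*} [NormedAddCommGroup X] [InnerProductSpace ℂ X]
    [CompleteSpace X] (H : X →ₗ.[ℂ] X) (U : ℝ → X →L[ℂ] X) : Prop where
  unitary (t : ℝ) : U t ∈ unitary (X →L[ℂ] X)
  map_zero : U 0 = 1
  map_add (s t : ℝ) : U (s + t) = U s * U t
  continuous (ψ : X) : Continuous fun t : ℝ => U t ψ
  generator (ψ φ : X) :
    (ψ, φ) ∈ H.graph ↔ HasDerivAt (fun t : ℝ => U t ψ) (-(I • φ)) 0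

open scoped Classical in
/-- `unitaryGroup H t` is `e^{-itH}`: the strongly continuous one-parameter unitary group with
infinitesimal generator `-iH`. Such a group exists and is unique for every self-adjoint `H`; for
operators `H` without such a group the value is the identity by convention. -/
def unitaryGroup {X : Type*} [NormedAddCommGroup X] [InnerProductSpace ℂ X] [CompleteSpace X]
    (H : X →ₗ.[ℂ] X) : ℝ → X →L[ℂ] X :=
  if h : ∃ U : ℝ → X →L[ℂ] X, IsUnitaryGroupGeneratedBy H U then h.choose else fun _ => 1

end

/-! The difference quotient of `⟨ψ, Aψ⟩` between `t` and `s` equals `⟨q, Aψ(s)⟩ + ⟨Aψ(t), q⟩`, with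
`q` the difference quotient of `ψ`: the mixed terms cancel because `A` is hermitean. Since `q`
converges in norm to `-iHψ(t)`, it suffices that `Aψ(s)` tends weakly to `Aψ(t)`. A closed graph is
convex, hence weakly closed, so this follows as soon as `Aψ(s)` stays bounded near `t`
(`LinearPMap.IsClosed.tendsto_inner`).

Local boundedness is a Baire argument (`exists_uniform_bound_on_interval`) on `ℝ × Y`, where `Y` is
`D(A) ∩ D(H)` with the joint graph norm. It yields one time interval on which every orbit is bounded
under `A`, and the group law moves that interval to any time. Continuity of the derivative uses the
same weak-strong pairing, as `Hψ(t) = e^{-itH}Hψ₀` is norm continuous.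

Stone's existence theorem is needed to know that `unitaryGroup H` is not its default value; it is
obtained by Yosida approximation. -/

open Filter Topology

/-! ### Resolvents and Yosida approximation of a self-adjoint operator -/

section SelfAdjointGraph

variable {X : Type*} [NormedAddCommGroup X] [InnerProductSpace ℂ X]

/-- `R` is the everywhere defined bounded inverse of `H - il`. -/
structure IsResolventAt (H : X →ₗ.[ℂ] X) (l : ℝ) (R : X →L[ℂ] X) : Prop where
  mem_graph (y : X) : (R y, y + ((l : ℂ) * I) • R y) ∈ H.graph
  apply_sub {x z : X} (h : (x, z) ∈ H.graph) : R (z - ((l : ℂ) * I) • x) = x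
  norm_le (y : X) : |l| * ‖R y‖ ≤ ‖y‖

theorem IsResolventAt.sub_eq {H : X →ₗ.[ℂ] X} {l m : ℝ} {R S : X →L[ℂ] X}
    (hR : IsResolventAt H l R) (hS : IsResolventAt H m S) (y : X) :
    R y - S y = (((l - m : ℝ) : ℂ) * I) • R (S y) := by
  have h := hR.apply_sub (hS.mem_graph y)
  have h' : y + ((m : ℂ) * I) • S y - ((l : ℂ) * I) • S y
      = y - (((l - m : ℝ) : ℂ) * I) • S y := by push_cast; module
  rw [h', map_sub, map_smul] at h
  rw [sub_eq_iff_eq_add] at h ⊢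
  rw [h, add_comm]

/-- Exchanging the roles of `R` and `S` in the resolvent identity changes the sign of both the left
side and the scalar. -/
theorem IsResolventAt.commute {H : X →ₗ.[ℂ] X} {l m : ℝ} {R S : X →L[ℂ] X}
    (hR : IsResolventAt H l R) (hS : IsResolventAt H m S) : Commute R S := by
  ext y
  change R (S y) = S (R y)
  by_cases hlm : l = m
  · subst hlm
    have h (z : X) : R z = S z := sub_eq_zero.1 (by simpa using hR.sub_eq hS z)
    simp [h]
  · have h1 := hR.sub_eq hS y
    have h2 := hS.sub_eq hR y
    have hc : (((l - m : ℝ) : ℂ) * I) ≠ 0 := by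
      simpa [sub_eq_zero] using fun h : (l : ℂ) = m => hlm (by exact_mod_cast h)
    refine smul_right_injective X hc ?_
    change (((l - m : ℝ) : ℂ) * I) • R (S y) = (((l - m : ℝ) : ℂ) * I) • S (R y)
    rw [← h1, ← neg_sub (S y), h2, ← neg_smul]
    congr 1
    push_cast; ring

theorem tendsto_of_dense_of_norm_le {S : ℕ → X →L[ℂ] X} (hS : ∀ n x, ‖S n x‖ ≤ ‖x‖) {D : Set X}
    (hD : Dense D) (h : ∀ x ∈ D, Tendsto (fun n => S n x) atTop (𝓝 x)) (x : X) :
    Tendsto (fun n => S n x) atTop (𝓝 x) := by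
  rw [Metric.tendsto_nhds]
  intro ε hε
  obtain ⟨z, hz, hxz⟩ := Metric.dense_iff.1 hD x (ε / 3) (by positivity)
  have hxz' : ‖x - z‖ < ε / 3 := by rw [← dist_eq_norm, dist_comm]; exact hz
  filter_upwards [Metric.tendsto_nhds.1 (h z hxz) (ε / 3) (by positivity)] with n hn
  rw [dist_eq_norm] at hn ⊢
  have h1 : S n x - x = S n (x - z) + (S n z - z) - (x - z) := by rw [map_sub]; abel
  rw [h1]
  have := norm_sub_le (S n (x - z) + (S n z - z)) (x - z)
  have := norm_add_le (S n (x - z)) (S n z - z)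
  have := hS n (x - z)
  linarith

variable [CompleteSpace X]

theorem IsSelfAdjoint.mem_graph_iff {H : X →ₗ.[ℂ] X} (hH : IsSelfAdjoint H) {x y : X} :
    (x, y) ∈ H.graph ↔ ∀ a b, (a, b) ∈ H.graph → inner ℂ b x = inner ℂ a y := by
  have h := LinearPMap.adjoint_graph_eq_graph_adjoint hH.dense_domain
  rw [LinearPMap.isSelfAdjoint_def.mp hH] at h
  conv_lhs => rw [h]
  simp only [Submodule.mem_adjoint_iff, sub_eq_zero]

theorem IsSelfAdjoint.inner_graph {H : X →ₗ.[ℂ] X} (hH : IsSelfAdjoint H) {x y a b : X}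
    (h : (x, y) ∈ H.graph) (h' : (a, b) ∈ H.graph) : inner ℂ b x = inner ℂ a y :=
  hH.mem_graph_iff.1 h a b h'

/-- Symmetry makes `⟨y, x⟩` real, so the cross term vanishes. -/
theorem IsSelfAdjoint.norm_sub_sq_graph {H : X →ₗ.[ℂ] X} (hH : IsSelfAdjoint H) {x y : X}
    (h : (x, y) ∈ H.graph) (l : ℝ) :
    ‖y - ((l : ℂ) * I) • x‖ ^ 2 = ‖y‖ ^ 2 + l ^ 2 * ‖x‖ ^ 2 := by
  have him : (inner ℂ y x).im = 0 := by
    have h1 : (starRingEnd ℂ) (inner ℂ y x) = inner ℂ y x := by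
      rw [inner_conj_symm]; exact (hH.inner_graph h h).symm
    exact Complex.conj_eq_iff_im.1 h1
  rw [norm_sub_sq (𝕜 := ℂ), inner_smul_right]
  simp [him, norm_smul, mul_pow]

/-- By the norm identity `H - il` is bounded below on its complete graph, so its range is closed. A
vector orthogonal to the range would be an eigenvector of `H* = H` with eigenvalue `-il`, which the
same identity with `-l` excludes. -/
theorem IsSelfAdjoint.exists_isResolventAt {H : X →ₗ.[ℂ] X} (hH : IsSelfAdjoint H) {l : ℝ}
    (hl : l ≠ 0) : ∃ R, IsResolventAt H l R := by
  have hcomplete : CompleteSpace H.graph := hH.isClosed.completeSpace_coe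
  have hnorm {x y : X} (h : (x, y) ∈ H.graph) :
      ‖y‖ ≤ ‖y - ((l : ℂ) * I) • x‖ ∧ |l| * ‖x‖ ≤ ‖y - ((l : ℂ) * I) • x‖ := by
    have := hH.norm_sub_sq_graph h l
    constructor
    · refine abs_le_of_sq_le_sq' ?_ (norm_nonneg _) |>.2
      nlinarith [mul_nonneg (sq_nonneg l) (sq_nonneg ‖x‖)]
    · refine abs_le_of_sq_le_sq' ?_ (norm_nonneg _) |>.2
      rw [mul_pow, sq_abs]
      nlinarith [sq_nonneg ‖y‖]
  let T : H.graph →L[ℂ] X :=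
    (ContinuousLinearMap.snd ℂ X X - ((l : ℂ) * I) • ContinuousLinearMap.fst ℂ X X).comp
      H.graph.subtypeL
  have hT (p : H.graph) : T p = p.1.2 - ((l : ℂ) * I) • p.1.1 := rfl
  have hanti : AntilipschitzWith (max 1 ‖l‖₊⁻¹) T := by
    refine AddMonoidHomClass.antilipschitz_of_bound T fun p => ?_
    obtain ⟨h1, h2⟩ := hnorm (x := p.1.1) (y := p.1.2) p.2
    rw [← hT] at h1 h2
    have hl' : 0 < |l| := abs_pos.2 hl
    change max ‖p.1.1‖ ‖p.1.2‖ ≤ _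
    rw [NNReal.coe_max, max_mul_of_nonneg _ _ (norm_nonneg _), max_comm]
    refine max_le_max (by simpa using h1) ?_
    rw [NNReal.coe_inv, coe_nnnorm, Real.norm_eq_abs]
    rwa [le_inv_mul_iff₀ hl']
  have hclosed : IsClosed (T.range : Set X) := by
    rw [LinearMap.coe_range]
    exact hanti.isClosed_range T.uniformContinuous
  have hrange : T.range = ⊤ := by
    rw [← hclosed.submodule_topologicalClosure_eq, Submodule.topologicalClosure_eq_top_iff,
      Submodule.eq_bot_iff]
    intro w hw
    have hmem : (w, -(((l : ℂ) * I) • w)) ∈ H.graph := by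
      refine hH.mem_graph_iff.2 fun a b hab => ?_
      have h0 : inner ℂ (b - ((l : ℂ) * I) • a) w = 0 :=
        (Submodule.mem_orthogonal _ _).1 hw _ ⟨⟨(a, b), hab⟩, rfl⟩
      rw [inner_sub_left, inner_smul_left, sub_eq_zero] at h0
      rw [h0, inner_neg_right, inner_smul_right]
      simp
    have h := hH.norm_sub_sq_graph hmem (-l)
    have h0 : -(((l : ℂ) * I) • w) - (((-l : ℝ) : ℂ) * I) • w = 0 := by
      push_cast; module
    rw [h0] at h
    have : 0 < l ^ 2 := by positivity
    have hw0 : ‖w‖ ^ 2 = 0 := by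
      have h3 : l ^ 2 * ‖w‖ ^ 2 = 0 := by
        have : 0 ≤ l ^ 2 * ‖w‖ ^ 2 := by positivity
        have : 0 ≤ ‖-(((l : ℂ) * I) • w)‖ ^ 2 := by positivity
        norm_num at h
        nlinarith
      rcases mul_eq_zero.1 h3 with h | h
      · exact absurd h this.ne'
      · exact h
    simpa using hw0
  let e : H.graph ≃ₗ[ℂ] X := LinearEquiv.ofBijective T.toLinearMap
    ⟨hanti.injective, LinearMap.range_eq_top.1 hrange⟩
  have he (p : H.graph) : e p = p.1.2 - ((l : ℂ) * I) • p.1.1 := rfl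
  have hl' : 0 < |l| := abs_pos.2 hl
  have hbound (y : X) : |l| * ‖(e.symm y).1.1‖ ≤ ‖y‖ := by
    have := (hnorm (x := (e.symm y).1.1) (y := (e.symm y).1.2) (e.symm y).2).2
    rwa [← he, e.apply_symm_apply] at this
  refine ⟨LinearMap.mkContinuous
    ((LinearMap.fst ℂ X X).comp (H.graph.subtype.comp e.symm.toLinearMap)) |l|⁻¹ fun y => ?_,
    fun y => ?_, fun {x z} h => ?_, hbound⟩
  · rw [le_inv_mul_iff₀ hl']; exact hbound y
  · have h1 := he (e.symm y)
    rw [e.apply_symm_apply] at h1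
    have h2 : y + ((l : ℂ) * I) • (e.symm y).1.1 = (e.symm y).1.2 := by
      nth_rewrite 1 [h1]; simp
    change ((e.symm y).1.1, y + ((l : ℂ) * I) • (e.symm y).1.1) ∈ H.graph
    rw [h2]
    exact (e.symm y).2
  · change (e.symm (e ⟨(x, z), h⟩)).1.1 = x
    rw [e.symm_apply_apply]

theorem IsResolventAt.inner_apply {H : X →ₗ.[ℂ] X} (hH : IsSelfAdjoint H) {l : ℝ}
    {R S : X →L[ℂ] X} (hR : IsResolventAt H l R) (hS : IsResolventAt H (-l) S) (x y : X) :
    inner ℂ (R x) y = inner ℂ x (S y) := by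
  have h := hH.inner_graph (hS.mem_graph y) (hR.mem_graph x)
  rw [inner_add_left, inner_add_right, inner_smul_left, inner_smul_right] at h
  simp at h
  exact h.symm

/-- Yosida approximation: a self-adjoint operator is the strong limit of a sequence of commuting
bounded self-adjoint operators. -/
theorem IsSelfAdjoint.exists_bounded_approximation {H : X →ₗ.[ℂ] X} (hH : IsSelfAdjoint H) :
    ∃ B : ℕ → X →L[ℂ] X, (∀ n, IsSelfAdjoint (B n)) ∧ (∀ m n, Commute (B m) (B n)) ∧
      ∀ x y, (x, y) ∈ H.graph → Tendsto (fun n => B n x) atTop (𝓝 y) := by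
  let N : ℕ → ℝ := fun n => n + 1
  have hN (n : ℕ) : 0 < N n := by positivity
  choose R hR using fun n : ℕ => hH.exists_isResolventAt (hN n).ne'
  choose S hS using fun n : ℕ => hH.exists_isResolventAt (neg_ne_zero.2 (hN n).ne')
  have hRn (n : ℕ) (y : X) : N n * ‖R n y‖ ≤ ‖y‖ := by
    simpa [abs_of_pos (hN n)] using (hR n).norm_le y
  have hSn (n : ℕ) (y : X) : N n * ‖S n y‖ ≤ ‖y‖ := by
    simpa [abs_of_pos (hN n)] using (hS n).norm_le y
  have hRx (n : ℕ) {x y : X} (h : (x, y) ∈ H.graph) :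
      R n y = x + ((N n : ℂ) * I) • R n x := by
    have := (hR n).apply_sub h
    rw [map_sub, map_smul, sub_eq_iff_eq_add] at this
    exact this
  have hSx (n : ℕ) {x y : X} (h : (x, y) ∈ H.graph) :
      S n y = x - ((N n : ℂ) * I) • S n x := by
    have := (hS n).apply_sub h
    rw [map_sub, map_smul, sub_eq_iff_eq_add] at this
    rw [this]; push_cast; module
  -- Formally `J n = N²(H² + N²)⁻¹`, which tends strongly to the identity; the approximants below
  -- are `J n` composed with `H`.
  let J : ℕ → X →L[ℂ] X := fun n => ((N n : ℂ) * I / 2) • (S n - R n)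
  have hJn (n : ℕ) (y : X) : ‖J n y‖ ≤ ‖y‖ := by
    change ‖((N n : ℂ) * I / 2) • (S n y - R n y)‖ ≤ ‖y‖
    have h1 : ‖(N n : ℂ) * I / 2‖ = N n / 2 := by simp [abs_of_pos (hN n)]
    rw [norm_smul, h1]
    have := norm_sub_le (S n y) (R n y)
    nlinarith [hRn n y, hSn n y, hN n]
  have hNinv : Tendsto (fun n => (N n)⁻¹) atTop (𝓝 0) := by
    simpa [N] using tendsto_one_div_add_atTop_nhds_zero_nat (𝕜 := ℝ)
  have hzero {Q : ℕ → X →L[ℂ] X} (hQ : ∀ n y, N n * ‖Q n y‖ ≤ ‖y‖) (y : X) :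
      Tendsto (fun n => Q n y) atTop (𝓝 0) := by
    refine squeeze_zero_norm (a := fun n => (N n)⁻¹ * ‖y‖) (fun n => ?_)
      (by simpa using hNinv.mul_const ‖y‖)
    rw [le_inv_mul_iff₀ (hN n)]
    exact hQ n y
  have hJdom (x : X) (hx : x ∈ (H.domain : Set X)) : Tendsto (fun n => J n x) atTop (𝓝 x) := by
    have hg := H.mem_graph ⟨x, hx⟩
    set y := H ⟨x, hx⟩
    have h1 (n : ℕ) : J n x = x - (1 / 2 : ℂ) • (S n y + R n y) := by
      rw [hRx n hg, hSx n hg]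
      change ((N n : ℂ) * I / 2) • (S n x - R n x) = _
      module
    simp_rw [h1]
    have h2 := ((hzero hSn y).add (hzero hRn y)).const_smul (1 / 2 : ℂ)
    simpa using h2.const_sub x
  have hJ := tendsto_of_dense_of_norm_le hJn hH.dense_domain hJdom
  refine ⟨fun n => (((N n ^ 2 / 2 : ℝ) : ℂ)) • (R n + S n), fun n => ?_, fun m n => ?_,
    fun x y h => ?_⟩
  · rw [ContinuousLinearMap.isSelfAdjoint_iff_isSymmetric]
    intro x y
    have h1 := (hR n).inner_apply hH (hS n) x y
    have h2 := (hS n).inner_apply hH (by simpa using hR n) x y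
    simp only [ContinuousLinearMap.coe_coe, smul_apply,
      add_apply, inner_smul_left, inner_smul_right, inner_add_left,
      inner_add_right, h1, h2, Complex.conj_ofReal]
    ring
  · refine Commute.smul_left (Commute.smul_right ?_ _) _
    exact (((hR m).commute (hR n)).add_right ((hR m).commute (hS n))).add_left
      (((hS m).commute (hR n)).add_right ((hS m).commute (hS n)))
  · have h1 (n : ℕ) : (((N n ^ 2 / 2 : ℝ) : ℂ) • (R n + S n)) x = J n y := by
      change ((N n ^ 2 / 2 : ℝ) : ℂ) • (R n x + S n x) = ((N n : ℂ) * I / 2) • (S n y - R n y)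
      rw [hRx n h, hSx n h]
      simp only [smul_add, smul_sub, smul_smul]
      have h3 : (N n : ℂ) * I / 2 * (N n * I) = - (N n ^ 2 / 2 : ℝ) := by
        push_cast; linear_combination ((N n : ℂ) ^ 2 / 2) * I_sq
      rw [h3]
      module
    simp_rw [h1]
    exact hJ y

end SelfAdjointGraph

/-! ### Stone's theorem: existence of the unitary group -/

section Stone

variable {X : Type*} [NormedAddCommGroup X] [InnerProductSpace ℂ X] [CompleteSpace X]

/-- `e^{-itK}` for a bounded operator `K`. -/
noncomputable def boundedGroup (K : X →L[ℂ] X) (t : ℝ) : X →L[ℂ] X :=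
  NormedSpace.exp (t • (-I • K))

theorem boundedGroup_zero (K : X →L[ℂ] X) : boundedGroup K 0 = 1 := by
  simp [boundedGroup]

theorem boundedGroup_add (K : X →L[ℂ] X) (s t : ℝ) :
    boundedGroup K (s + t) = boundedGroup K s * boundedGroup K t := by
  let +nondep : NormedAlgebra ℚ (X →L[ℂ] X) := .restrictScalars ℚ ℂ _
  rw [boundedGroup, add_smul]
  exact NormedSpace.exp_add_of_commute (((Commute.refl _).smul_left s).smul_right t)

theorem boundedGroup_eq_mul {K L : X →L[ℂ] X} (h : Commute K L) (t : ℝ) :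
    boundedGroup K t = boundedGroup L t * boundedGroup (K - L) t := by
  let +nondep : NormedAlgebra ℚ (X →L[ℂ] X) := .restrictScalars ℚ ℂ _
  rw [boundedGroup, boundedGroup, boundedGroup, ← NormedSpace.exp_add_of_commute]
  · congr 1
    module
  · exact ((((h.symm.sub_right (Commute.refl L)).smul_left _).smul_right _).smul_left t).smul_right t

theorem inner_boundedGroup {K : X →L[ℂ] X} (hK : IsSelfAdjoint K) (t : ℝ) (x y : X) :
    inner ℂ (boundedGroup K t x) (boundedGroup K t y) = inner ℂ x y := by
  let +nondep : NormedAlgebra ℚ (X →L[ℂ] X) := .restrictScalars ℚ ℂ _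
  have h : boundedGroup K t ∈ unitary (X →L[ℂ] X) := by
    refine NormedSpace.exp_mem_unitary_of_mem_skewAdjoint ?_
    rw [skewAdjoint.mem_iff, star_smul, star_smul, hK.star_eq]
    simp
  exact ((ContinuousLinearMap.inner_map_map_iff_adjoint_comp_self _).2 h.1) x y

theorem norm_boundedGroup {K : X →L[ℂ] X} (hK : IsSelfAdjoint K) (t : ℝ) (x : X) :
    ‖boundedGroup K t x‖ = ‖x‖ := by
  have h := inner_boundedGroup hK t x x
  rw [inner_self_eq_norm_sq_to_K, inner_self_eq_norm_sq_to_K] at h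
  exact (sq_eq_sq₀ (norm_nonneg _) (norm_nonneg _)).1 (by exact_mod_cast h)

theorem hasDerivAt_boundedGroup (K : X →L[ℂ] X) (t : ℝ) (x : X) :
    HasDerivAt (fun t => boundedGroup K t x) (boundedGroup K t (-(I • K x))) t := by
  have h := hasDerivAt_exp_smul_const (𝕂 := ℝ) (-I • K) t
  have h2 := ((ContinuousLinearMap.apply ℂ X x).restrictScalars ℝ).hasFDerivAt.comp_hasDerivAt t h
  have h3 : boundedGroup K t (-(I • K x)) = (boundedGroup K t * (-I • K)) x := by
    rw [neg_smul, mul_neg, mul_smul_comm]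
    simp
  rw [h3]
  exact h2

theorem norm_boundedGroup_sub_self_le {K : X →L[ℂ] X} (hK : IsSelfAdjoint K) (t : ℝ) (x : X) :
    ‖boundedGroup K t x - x‖ ≤ |t| * ‖K x‖ := by
  have h := Convex.norm_image_sub_le_of_norm_hasDerivWithin_le (s := Set.univ)
    (f := fun t => boundedGroup K t x) (C := ‖K x‖) (x := 0) (y := t)
    (fun s _ => (hasDerivAt_boundedGroup K s x).hasDerivWithinAt)
    (fun s _ => by rw [norm_boundedGroup hK, norm_neg, norm_smul]; simp) convex_univ
    trivial trivial
  simpa [boundedGroup_zero, mul_comm] using h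

/-- Commutation allows the isometry `e^{-itL}` to be factored out, leaving `e^{-it(K-L)}x - x`. -/
theorem norm_boundedGroup_sub_le {K L : X →L[ℂ] X} (hK : IsSelfAdjoint K) (hL : IsSelfAdjoint L)
    (h : Commute K L) (t : ℝ) (x : X) :
    ‖boundedGroup K t x - boundedGroup L t x‖ ≤ |t| * ‖K x - L x‖ := by
  rw [boundedGroup_eq_mul h, mul_apply_eq_comp, ← map_sub, norm_boundedGroup hL]
  exact norm_boundedGroup_sub_self_le (hK.sub hL) t x

/-- On `D` the previous estimate is uniform for bounded `t`; isometry carries this to all `x` by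
density. -/
theorem uniformCauchySeqOn_boundedGroup {B : ℕ → X →L[ℂ] X} (hB : ∀ n, IsSelfAdjoint (B n))
    (hcomm : ∀ m n, Commute (B m) (B n)) {D : Set X} (hD : Dense D)
    (hlim : ∀ x ∈ D, ∃ y, Tendsto (fun n => B n x) atTop (𝓝 y)) (x : X) (T : ℝ) :
    UniformCauchySeqOn (fun n t => boundedGroup (B n) t x) atTop (Metric.ball 0 T) := by
  rw [Metric.uniformCauchySeqOn_iff]
  intro ε hε
  obtain ⟨z, hz, hzD⟩ := Metric.dense_iff.1 hD x (ε / 4) (by positivity)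
  have hxz : ‖x - z‖ < ε / 4 := by rw [← dist_eq_norm, dist_comm]; exact hz
  obtain ⟨y, hy⟩ := hlim z hzD
  obtain ⟨N, hN⟩ := Metric.cauchySeq_iff.1 hy.cauchySeq (ε / (2 * (|T| + 1))) (by positivity)
  refine ⟨N, fun m hm n hn t ht => ?_⟩
  have h1 := norm_boundedGroup_sub_le (hB m) (hB n) (hcomm m n) t z
  have h2 := hN m hm n hn
  have ht' : |t| ≤ |T| + 1 := by
    have : |t| < T := by simpa using ht
    linarith [le_abs_self T]
  rw [dist_eq_norm, lt_div_iff₀ (by positivity)] at h2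
  have h3 : |t| * ‖B m z - B n z‖ ≤ (|T| + 1) * ‖B m z - B n z‖ := by gcongr
  have h4 : boundedGroup (B m) t x - boundedGroup (B n) t x =
      boundedGroup (B m) t (x - z) + (boundedGroup (B m) t z - boundedGroup (B n) t z) -
        boundedGroup (B n) t (x - z) := by
    rw [map_sub, map_sub]; abel
  rw [dist_eq_norm, h4]
  refine (norm_sub_le_of_le (norm_add_le_of_le (norm_boundedGroup (hB m) t _).le h1)
    (norm_boundedGroup (hB n) t _).le).trans_lt ?_
  linarith

/-- **Stone's theorem**, existence part: a self-adjoint operator generates a strongly continuous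
one-parameter unitary group. -/
theorem IsSelfAdjoint.exists_isUnitaryGroupGeneratedBy {H : X →ₗ.[ℂ] X} (hH : IsSelfAdjoint H) :
    ∃ U : ℝ → X →L[ℂ] X, IsUnitaryGroupGeneratedBy H U := by
  obtain ⟨B, hB, hcomm, hlim⟩ := hH.exists_bounded_approximation
  have hcauchy := uniformCauchySeqOn_boundedGroup hB hcomm hH.dense_domain
    fun x hx => ⟨_, hlim x _ (H.mem_graph ⟨x, hx⟩)⟩
  have hex (t : ℝ) (x : X) : ∃ y, Tendsto (fun n => boundedGroup (B n) t x) atTop (𝓝 y) :=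
    cauchySeq_tendsto_of_complete <|
      (hcauchy x (|t| + 1)).cauchySeq (by simp)
  choose u hu using hex
  let U : ℝ → X →L[ℂ] X := fun t => continuousLinearMapOfTendsto
    (fun n => boundedGroup (B n) t) (f := u t) (tendsto_pi_nhds.2 (hu t))
  have hU (t : ℝ) (x : X) : Tendsto (fun n => boundedGroup (B n) t x) atTop (𝓝 (U t x)) := hu t x
  have hunif (x : X) :
      TendstoLocallyUniformlyOn (fun n t => boundedGroup (B n) t x) (fun t => U t x) atTop
        Set.univ := by
    have h (T : ℝ) := (hcauchy x T).tendstoUniformlyOn_of_tendsto fun t _ => hU t x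
    rw [tendstoLocallyUniformlyOn_univ, tendstoLocallyUniformly_iff_forall_isCompact]
    intro K hK
    obtain ⟨T, hT⟩ := hK.isBounded.subset_ball 0
    exact (h T).mono hT
  have hinner (t : ℝ) (x y : X) : inner ℂ (U t x) (U t y) = inner ℂ x y := by
    refine tendsto_nhds_unique ((hU t x).inner (hU t y)) ?_
    simp_rw [inner_boundedGroup (hB _)]
    exact tendsto_const_nhds
  have hzero : U 0 = 1 := by
    ext x
    refine tendsto_nhds_unique (hU 0 x) ?_
    simp_rw [boundedGroup_zero]
    exact tendsto_const_nhds
  have hadd (s t : ℝ) : U (s + t) = U s * U t := by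
    ext x
    refine tendsto_nhds_unique (hU (s + t) x) ?_
    have h1 := hU s (U t x)
    have h2 : Tendsto (fun n => boundedGroup (B n) s (boundedGroup (B n) t x - U t x)) atTop
        (𝓝 0) := by
      rw [tendsto_zero_iff_norm_tendsto_zero]
      simp_rw [norm_boundedGroup (hB _)]
      rw [← tendsto_zero_iff_norm_tendsto_zero]
      simpa using (hU t x).sub_const (U t x)
    have h3 := h2.add h1
    rw [zero_add] at h3
    refine h3.congr fun n => ?_
    rw [map_sub, boundedGroup_add, mul_apply_eq_comp, sub_add_cancel]
  have hstar (t : ℝ) : star (U t) * U t = 1 :=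
    (ContinuousLinearMap.inner_map_map_iff_adjoint_comp_self _).1 (hinner t)
  have hinv (t : ℝ) : U t * U (-t) = 1 := by rw [← hadd, add_neg_cancel, hzero]
  have hderiv {x y : X} (h : (x, y) ∈ H.graph) :
      HasDerivAt (fun t => U t x) (-(I • y)) 0 := by
    -- Locally uniform convergence of the derivatives permits differentiating the limit.
    have h1 : TendstoLocallyUniformlyOn (fun n t => boundedGroup (B n) t (-(I • B n x)))
        (fun t => U t (-(I • y))) atTop Set.univ := by
      have h2 := hunif (-(I • y))
      rw [Metric.tendstoLocallyUniformlyOn_iff] at h2 ⊢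
      intro ε hε t ht
      obtain ⟨s, hs, hs'⟩ := h2 (ε / 2) (by positivity) t ht
      refine ⟨s, hs, ?_⟩
      filter_upwards [hs', Metric.tendsto_nhds.1 (hlim x y h) (ε / 2) (by positivity)]
        with n hn hn' r hr
      have h3 : dist (boundedGroup (B n) r (-(I • y))) (boundedGroup (B n) r (-(I • B n x)))
          < ε / 2 := by
        rw [dist_eq_norm, ← map_sub, norm_boundedGroup (hB n), ← neg_sub', ← smul_sub, norm_neg,
          norm_smul, norm_I, one_mul, ← dist_eq_norm, dist_comm]
        exact hn'
      linarith [dist_triangle (U r (-(I • y))) (boundedGroup (B n) r (-(I • y)))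
        (boundedGroup (B n) r (-(I • B n x))), hn r hr]
    have h2 := hasDerivAt_of_tendstoLocallyUniformlyOn isOpen_univ h1
      (Eventually.of_forall fun n t _ => hasDerivAt_boundedGroup (B n) t x) (fun t _ => hU t x)
      (Set.mem_univ (0 : ℝ))
    simpa [hzero] using h2
  refine ⟨U, fun t => ?_, hzero, hadd, fun x => ?_, fun x y => ⟨hderiv, fun h => ?_⟩⟩
  · refine Unitary.mem_iff.2 ⟨hstar t, ?_⟩
    have h : star (U t) = U (-t) := by
      calc star (U t) = star (U t) * (U t * U (-t)) := by rw [hinv, mul_one]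
        _ = U (-t) := by rw [← mul_assoc, hstar, one_mul]
    rw [h, hinv]
  · rw [← continuousOn_univ]
    exact (hunif x).continuousOn (Frequently.of_forall fun n => Continuous.continuousOn <|
      continuous_iff_continuousAt.2 fun t => (hasDerivAt_boundedGroup (B n) t x).continuousAt)
  -- Differentiating the constant `⟨U t a, U t x⟩` at `0` puts `(x, y)` in the graph of the adjoint,
  -- which is that of `H`.
  · refine hH.mem_graph_iff.2 fun a b hab => ?_
    have h1 := (hderiv hab).inner ℂ h
    simp_rw [hinner] at h1
    have h2 := h1.unique (hasDerivAt_const _ _)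
    simp only [hzero, one_apply_eq_self, inner_neg_left, inner_neg_right,
      inner_smul_left, inner_smul_right, conj_I] at h2
    have h3 : I * (inner ℂ b x - inner ℂ a y) = 0 := by linear_combination h2
    exact sub_eq_zero.1 ((mul_eq_zero.1 h3).resolve_left I_ne_zero)

end Stone

/-! ### Weak limits and closed graphs -/

section WeakLimits

variable {X : Type*} [NormedAddCommGroup X] [InnerProductSpace ℂ X] [CompleteSpace X]

/-- Banach–Alaoglu, transported by the Riesz isomorphism. -/
theorem exists_weak_limit_of_norm_le {ι : Type*} (F : Ultrafilter ι) {y : ι → X} {C : ℝ}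
    (hy : ∀ᶠ i in (F : Filter ι), ‖y i‖ ≤ C) :
    ∃ b : X, ‖b‖ ≤ C ∧ ∀ w, Tendsto (fun i => inner ℂ (y i) w) F (𝓝 (inner ℂ b w)) := by
  let g : ι → WeakDual ℂ X := fun i =>
    StrongDual.toWeakDual (InnerProductSpace.toDual ℂ X (y i))
  have hK := WeakDual.isCompact_closedBall (𝕜 := ℂ) (E := X) 0 C
  obtain ⟨f, hf, hlim⟩ := hK.ultrafilter_le_nhds (F.map g) <| by
    rw [le_principal_iff]
    change ∀ᶠ i in (F : Filter ι), _
    filter_upwards [hy] with i hi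
    change InnerProductSpace.toDual ℂ X (y i) ∈ Metric.closedBall 0 C
    simpa using hi
  refine ⟨(InnerProductSpace.toDual ℂ X).symm (WeakDual.toStrongDual f), ?_, fun w => ?_⟩
  · rw [LinearIsometryEquiv.norm_map]
    simpa using hf
  · rw [InnerProductSpace.toDual_symm_apply]
    have h := ((WeakDual.eval_continuous w).tendsto f).comp hlim
    exact h

/-- Otherwise Hahn–Banach separates `(a, b)` from `G`. The separating functional is a sum of one
functional in each variable, so it passes to the limit, which contradicts strict separation. -/
theorem Convex.mem_of_tendsto_of_weak_tendsto {ι : Type*} {l : Filter ι} [l.NeBot]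
    {G : Set (X × X)} (hG : Convex ℝ G) (hGc : IsClosed G) {x y : ι → X} {a b : X}
    (hg : ∀ i, (x i, y i) ∈ G) (hx : Tendsto x l (𝓝 a))
    (hy : ∀ w, Tendsto (fun i => inner ℂ (y i) w) l (𝓝 (inner ℂ b w))) : (a, b) ∈ G := by
  by_contra hab
  obtain ⟨f, u, hfu, hu⟩ := RCLike.geometric_hahn_banach_closed_point (𝕜 := ℂ) hG hGc hab
  let v : X := (InnerProductSpace.toDual ℂ X).symm (f.comp (ContinuousLinearMap.inr ℂ X X))
  have hf (p q : X) : f (p, q) = f.comp (ContinuousLinearMap.inl ℂ X X) p + inner ℂ v q := by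
    rw [InnerProductSpace.toDual_symm_apply]
    simp [← map_add]
  have hy' : Tendsto (fun i => inner ℂ v (y i)) l (𝓝 (inner ℂ v b)) := by
    have h := (Complex.continuous_conj.tendsto _).comp (hy v)
    simp only [inner_conj_symm] at h
    simpa [Function.comp_def] using h
  have h1 : Tendsto (fun i => f (x i, y i)) l (𝓝 (f (a, b))) := by
    simp_rw [hf]
    exact (((f.comp (ContinuousLinearMap.inl ℂ X X)).continuous.tendsto a).comp hx).add hy'
  have h2 := le_of_tendsto ((RCLike.continuous_re.tendsto _).comp h1)
    (Eventually.of_forall fun i => (hfu _ (hg i)).le)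
  exact absurd hu (not_lt.2 h2)

theorem LinearPMap.IsClosed.weak_limit_eq {A : X →ₗ.[ℂ] X} (hA : A.IsClosed) {ι : Type*}
    (F : Ultrafilter ι) {x y : ι → X} {a b : X} {C : ℝ} (hg : ∀ i, (x i, y i) ∈ A.graph)
    (hx : Tendsto x F (𝓝 a)) (hy : ∀ᶠ i in (F : Filter ι), ‖y i‖ ≤ C) (hab : (a, b) ∈ A.graph) :
    ‖b‖ ≤ C ∧ ∀ w, Tendsto (fun i => inner ℂ (y i) w) F (𝓝 (inner ℂ b w)) := by
  obtain ⟨b', hb', hlim⟩ := exists_weak_limit_of_norm_le F hy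
  have hmem : (a, b') ∈ A.graph :=
    Convex.mem_of_tendsto_of_weak_tendsto (G := (A.graph : Set (X × X)))
      (A.graph.restrictScalars ℝ).convex hA hg hx hlim
  obtain rfl := A.mem_graph_snd_inj hab hmem rfl
  exact ⟨hb', hlim⟩

/-- Along every ultrafilter the weak limit is the same `b`, so no subsequences are needed;
boundedness of `y` absorbs the norm-small error `v - w`. -/
theorem LinearPMap.IsClosed.tendsto_inner {A : X →ₗ.[ℂ] X} (hA : A.IsClosed) {ι : Type*}
    {l : Filter ι} {x y v : ι → X} {a b w : X} {C : ℝ} (hg : ∀ i, (x i, y i) ∈ A.graph)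
    (hx : Tendsto x l (𝓝 a)) (hy : ∀ᶠ i in l, ‖y i‖ ≤ C) (hab : (a, b) ∈ A.graph)
    (hv : Tendsto v l (𝓝 w)) :
    Tendsto (fun i => inner ℂ (y i) (v i)) l (𝓝 (inner ℂ b w)) := by
  have h1 : Tendsto (fun i => inner ℂ (y i) w) l (𝓝 (inner ℂ b w)) :=
    tendsto_iff_ultrafilter _ _ _ |>.2 fun F hF =>
      (hA.weak_limit_eq F hg (hx.mono_left hF) (hF hy) hab).2 w
  have h2 : Tendsto (fun i => inner ℂ (y i) (v i - w)) l (𝓝 0) := by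
    have h3 : Tendsto (fun i => C * ‖v i - w‖) l (𝓝 0) := by
      simpa using (tendsto_iff_norm_sub_tendsto_zero.1 hv).const_mul C
    refine squeeze_zero_norm' ?_ h3
    filter_upwards [hy] with i hi
    exact (norm_inner_le_norm _ _).trans (by gcongr)
  simpa [← inner_add_right] using h1.add h2

end WeakLimits

/-! ### Local boundedness along orbits and the product rule -/

section Ehrenfest

theorem baireSpace_real_prod (Y : Type*) [PseudoMetricSpace Y] [CompleteSpace Y] :
    BaireSpace (ℝ × Y) :=
  inferInstance

variable {X : Type*} [NormedAddCommGroup X] [InnerProductSpace ℂ X]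

theorem continuous_uncurry_of_norm_map {U : ℝ → X →L[ℂ] X} (hn : ∀ t x, ‖U t x‖ = ‖x‖)
    (hc : ∀ x, Continuous fun t => U t x) : Continuous fun q : ℝ × X => U q.1 q.2 := by
  rw [continuous_iff_continuousAt]
  rintro ⟨t, x⟩
  have h1 : Tendsto (fun q : ℝ × X => U q.1 (q.2 - x)) (𝓝 (t, x)) (𝓝 0) := by
    rw [tendsto_zero_iff_norm_tendsto_zero]
    simp_rw [hn]
    rw [← tendsto_zero_iff_norm_tendsto_zero]
    have := (continuous_snd (X := ℝ) (Y := X)).tendsto (t, x) |>.sub_const x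
    simpa using this
  have h2 : Tendsto (fun q : ℝ × X => U q.1 x) (𝓝 (t, x)) (𝓝 (U t x)) :=
    ((hc x).comp continuous_fst).tendsto (t, x)
  have h3 := h1.add h2
  simp only [map_sub, sub_add_cancel, zero_add] at h3
  exact h3

variable [CompleteSpace X]

/-- Baire category in time and initial vector jointly: a ball around some `(t₀, p₀)` carries a
uniform bound, and linearity in the vector extends it to each `x`, with a constant depending on `x`.
-/
theorem exists_uniform_bound_on_interval {U : ℝ → X →L[ℂ] X} (hn : ∀ t x, ‖U t x‖ = ‖x‖)
    (hc : ∀ x, Continuous fun t => U t x) {A H : X →ₗ.[ℂ] X} (hA : A.IsClosed) (hH : H.IsClosed)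
    (hinv : ∀ t, ∀ x ∈ A.domain ⊓ H.domain, U t x ∈ A.domain) :
    ∃ t₀ : ℝ, ∃ δ > 0, ∀ x ∈ A.domain ⊓ H.domain, ∃ C, ∀ t ∈ Metric.ball t₀ δ,
      ∀ w, (U t x, w) ∈ A.graph → ‖w‖ ≤ C := by
  -- The triples `(x, Ax, Hx)`: a closed subspace, hence complete, in bijection with `D(A) ∩ D(H)`.
  let Y : Submodule ℂ (X × X × X) :=
    A.graph.comap ((LinearMap.fst ℂ X (X × X)).prod
      ((LinearMap.fst ℂ X X).comp (LinearMap.snd ℂ X (X × X)))) ⊓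
    H.graph.comap ((LinearMap.fst ℂ X (X × X)).prod
      ((LinearMap.snd ℂ X X).comp (LinearMap.snd ℂ X (X × X))))
  have hYA (p : Y) : (p.1.1, p.1.2.1) ∈ A.graph := p.2.1
  have hYH (p : Y) : (p.1.1, p.1.2.2) ∈ H.graph := p.2.2
  have hYclosed : IsClosed (Y : Set (X × X × X)) :=
    (hA.preimage (f := fun p : X × X × X => (p.1, p.2.1)) (by fun_prop)).inter
      (hH.preimage (f := fun p : X × X × X => (p.1, p.2.2)) (by fun_prop))
  have : CompleteSpace Y := hYclosed.completeSpace_coe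
  have : BaireSpace (ℝ × Y) := baireSpace_real_prod Y
  have hex (t : ℝ) (p : Y) : ∃ w, (U t p.1.1, w) ∈ A.graph :=
    ⟨_, A.mem_graph ⟨_, hinv t p.1.1
      ⟨LinearPMap.mem_domain_of_mem_graph (hYA p), LinearPMap.mem_domain_of_mem_graph (hYH p)⟩⟩⟩
  choose a ha using hex
  have haU {t : ℝ} {p : Y} {w : X} (h : (U t p.1.1, w) ∈ A.graph) : w = a t p :=
    A.mem_graph_snd_inj h (ha t p) rfl
  have hcont : Continuous fun q : ℝ × Y => U q.1 q.2.1.1 :=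
    (continuous_uncurry_of_norm_map hn hc).comp
      (f := fun q : ℝ × Y => (q.1, q.2.1.1)) (by fun_prop)
  -- Closed because a norm bound survives weak limits, and `A` being closed identifies the limit.
  have hclosed (n : ℕ) : IsClosed {q : ℝ × Y | ‖a q.1 q.2‖ ≤ n} := by
    rw [isClosed_iff_ultrafilter]
    intro q F hF hq
    exact (hA.weak_limit_eq F (fun q : ℝ × Y => ha q.1 q.2) ((hcont.tendsto q).mono_left hF) hq
      (ha q.1 q.2)).1
  obtain ⟨n, ⟨t₀, p₀⟩, hint⟩ := nonempty_interior_of_iUnion_of_closed hclosed <| by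
    refine Set.eq_univ_of_forall fun q => Set.mem_iUnion.2 ?_
    exact exists_nat_ge ‖a q.1 q.2‖
  obtain ⟨δ, hδ, hball⟩ := Metric.mem_nhds_iff.1 (mem_interior_iff_mem_nhds.1 hint)
  refine ⟨t₀, δ, hδ, fun x hx => ?_⟩
  let p : Y := ⟨(x, A ⟨x, hx.1⟩, H ⟨x, hx.2⟩), A.mem_graph ⟨x, hx.1⟩, H.mem_graph ⟨x, hx.2⟩⟩
  -- Chosen so that `c‖p‖ < δ`, which keeps `p₀ + c p` in the ball.
  let c : ℝ := δ / (‖p‖ + 1)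
  have hc0 : 0 < c := by positivity
  refine ⟨(n + n) / c, fun t ht w hw => ?_⟩
  obtain rfl : w = a t p := haU hw
  have hp : (t, p₀ + (c : ℂ) • p) ∈ Metric.ball (t₀, p₀) δ := by
    rw [Metric.mem_ball, Prod.dist_eq, max_lt_iff]
    refine ⟨ht, ?_⟩
    rw [dist_eq_norm, add_sub_cancel_left, norm_smul, Complex.norm_real, Real.norm_eq_abs,
      abs_of_pos hc0, div_mul_eq_mul_div, div_lt_iff₀ (by positivity)]
    nlinarith
  have hp₀ : (t, p₀) ∈ Metric.ball (t₀, p₀) δ := by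
    rw [Metric.mem_ball, Prod.dist_eq, max_lt_iff]
    exact ⟨ht, by simpa using hδ⟩
  have hadd : a t (p₀ + (c : ℂ) • p) = a t p₀ + (c : ℂ) • a t p := by
    refine (haU ?_).symm
    have h := A.graph.add_mem (ha t p₀) (A.graph.smul_mem (c : ℂ) (ha t p))
    simpa using h
  have h1 : ‖a t (p₀ + (c : ℂ) • p)‖ ≤ n := hball hp
  have h2 : ‖a t p₀‖ ≤ n := hball hp₀
  rw [le_div_iff₀ hc0, mul_comm]
  calc c * ‖a t p‖ = ‖(c : ℂ) • a t p‖ := by rw [norm_smul]; simp [abs_of_pos hc0]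
    _ = ‖a t (p₀ + (c : ℂ) • p) - a t p₀‖ := by rw [hadd, add_sub_cancel_left]
    _ ≤ n + n := norm_sub_le_of_le h1 h2

namespace IsUnitaryGroupGeneratedBy

variable {H : X →ₗ.[ℂ] X} {U : ℝ → X →L[ℂ] X}

theorem norm_map (hU : IsUnitaryGroupGeneratedBy H U) (t : ℝ) (x : X) : ‖U t x‖ = ‖x‖ :=
  (ContinuousLinearMap.norm_map_iff_adjoint_comp_self _).2 (hU.unitary t).1 x

theorem add_apply (hU : IsUnitaryGroupGeneratedBy H U) (s t : ℝ) (x : X) :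
    U (s + t) x = U s (U t x) := by
  rw [hU.map_add]; rfl

theorem hasDerivAt (hU : IsUnitaryGroupGeneratedBy H U) {x y : X} (h : (x, y) ∈ H.graph)
    (t : ℝ) : HasDerivAt (fun t => U t x) (-(I • U t y)) t := by
  have h0 := (hU.generator x y).1 h
  have h1 : HasDerivAt (fun s => U (s - t) x) (-(I • y)) t := by
    have h0' : HasDerivAt (fun s => U s x) (-(I • y)) (t - t) := by simpa using h0
    exact h0'.comp_sub_const t t
  have h2 := ((U t).restrictScalars ℝ).hasFDerivAt.comp_hasDerivAt t h1
  have h3 : -(I • U t y) = U t (-(I • y)) := by simp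
  rw [h3]
  refine h2.congr_of_eventuallyEq (Eventually.of_forall fun s => ?_)
  change U s x = U t (U (s - t) x)
  rw [← hU.add_apply, add_sub_cancel]

theorem map_mem_graph (hU : IsUnitaryGroupGeneratedBy H U) {x y : X} (h : (x, y) ∈ H.graph)
    (t : ℝ) : (U t x, U t y) ∈ H.graph := by
  rw [hU.generator]
  have h1 := hU.hasDerivAt h (0 + t)
  have h2 := h1.comp_add_const 0 t
  simp_rw [hU.add_apply _ t] at h2
  simpa [hU.map_zero] using h2

/-- The orbit of `x` near `t` is the orbit of `U (t - t₀) x` near `t₀`, and invariance keeps that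
vector in `D(A) ∩ D(H)`. -/
theorem eventually_norm_le (hU : IsUnitaryGroupGeneratedBy H U) {A : X →ₗ.[ℂ] X}
    (hA : A.IsClosed) (hH : H.IsClosed)
    (hinv : ∀ t, ∀ x ∈ A.domain ⊓ H.domain, U t x ∈ A.domain ⊓ H.domain) {x : X}
    (hx : x ∈ A.domain ⊓ H.domain) (t : ℝ) :
    ∃ C, ∀ᶠ s in 𝓝 t, ∀ w, (U s x, w) ∈ A.graph → ‖w‖ ≤ C := by
  obtain ⟨t₀, δ, hδ, h⟩ := exists_uniform_bound_on_interval hU.norm_map hU.continuous hA hH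
    fun t x hx => (hinv t x hx).1
  obtain ⟨C, hC⟩ := h _ (hinv (t - t₀) x hx)
  refine ⟨C, ?_⟩
  filter_upwards [Metric.ball_mem_nhds t hδ] with s hs w hw
  refine hC (s - (t - t₀)) ?_ w ?_
  · rw [Metric.mem_ball, Real.dist_eq] at hs ⊢
    convert hs using 2
    ring
  · rwa [← hU.add_apply, sub_add_cancel]

end IsUnitaryGroupGeneratedBy

theorem IsSelfAdjoint.isHermitean {A : X →ₗ.[ℂ] X} (hA : IsSelfAdjoint A) : IsHermitean A :=
  fun ψ φ => hA.inner_graph (A.mem_graph φ) (A.mem_graph ψ)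

theorem IsSelfAdjoint.isUnitaryGroupGeneratedBy_unitaryGroup {H : X →ₗ.[ℂ] X}
    (hH : IsSelfAdjoint H) : IsUnitaryGroupGeneratedBy H (unitaryGroup H) := by
  have h := hH.exists_isUnitaryGroupGeneratedBy
  rw [unitaryGroup, dif_pos h]
  exact h.choose_spec

/-- Product rule for the expectation value of a closed hermitean operator `A` along a curve on which
`A` is locally bounded. -/
theorem IsHermitean.hasDerivAt_inner {A : X →ₗ.[ℂ] X} (hA : IsHermitean A) (hAc : A.IsClosed)
    {ψ : ℝ → X} (hψ : ∀ t, ψ t ∈ A.domain) {ψ' : X} {t : ℝ} (hd : HasDerivAt ψ ψ' t) {C : ℝ}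
    (hC : ∀ᶠ s in 𝓝 t, ‖A ⟨ψ s, hψ s⟩‖ ≤ C) :
    HasDerivAt (fun s => inner ℂ (ψ s) (A ⟨ψ s, hψ s⟩))
      (inner ℂ ψ' (A ⟨ψ t, hψ t⟩) + inner ℂ (A ⟨ψ t, hψ t⟩) ψ') t := by
  rw [hasDerivAt_iff_tendsto_slope] at hd ⊢
  have h1 := hAc.tendsto_inner (fun s => A.mem_graph ⟨ψ s, hψ s⟩)
    ((hasDerivAt_iff_tendsto_slope.2 hd).continuousAt.tendsto.mono_left nhdsWithin_le_nhds)
    (hC.filter_mono nhdsWithin_le_nhds) (A.mem_graph ⟨ψ t, hψ t⟩) hd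
  have h2 := (Complex.continuous_conj.tendsto _).comp h1
  simp only [Function.comp_def, inner_conj_symm] at h2
  have h3 : Tendsto (fun s => inner ℂ (A ⟨ψ t, hψ t⟩) (slope ψ t s)) (𝓝[≠] t)
      (𝓝 (inner ℂ (A ⟨ψ t, hψ t⟩) ψ')) := tendsto_const_nhds.inner hd
  refine (h2.add h3).congr fun s => ?_
  -- Hermiticity cancels the mixed terms, so `A` is never applied to a difference quotient.
  have h4 : inner ℂ (A ⟨ψ t, hψ t⟩) (ψ s) = inner ℂ (ψ t) (A ⟨ψ s, hψ s⟩) :=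
    hA ⟨ψ t, hψ t⟩ ⟨ψ s, hψ s⟩
  have h5 : inner ℂ (A ⟨ψ t, hψ t⟩) (ψ t) = inner ℂ (ψ t) (A ⟨ψ t, hψ t⟩) :=
    hA ⟨ψ t, hψ t⟩ ⟨ψ t, hψ t⟩
  simp only [slope_def_module, inner_smul_left_eq_smul, inner_smul_right_eq_smul, inner_sub_left,
    inner_sub_right, h4, h5, ← smul_add]
  congr 1
  ring

end Ehrenfest

theorem theorem1 {X : Type*} [NormedAddCommGroup X] [InnerProductSpace ℂ X] [CompleteSpace X]
    (A H : X →ₗ.[ℂ] X) (hH : IsSelfAdjoint H)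
    (hA : IsSelfAdjoint A ∨ (IsHermitean A ∧ A.IsClosed))
    (hinv : ∀ t : ℝ, ∀ φ ∈ A.domain ⊓ H.domain, unitaryGroup H t φ ∈ A.domain ⊓ H.domain)
    (ψ₀ : X) (hψ₀ : ψ₀ ∈ A.domain ⊓ H.domain) :
    ContDiff ℝ 1 (fun t : ℝ =>
      inner ℂ (unitaryGroup H t ψ₀) (A ⟨unitaryGroup H t ψ₀, (hinv t ψ₀ hψ₀).1⟩)) ∧
    ∀ t : ℝ, HasDerivAt (fun t : ℝ =>
        inner ℂ (unitaryGroup H t ψ₀) (A ⟨unitaryGroup H t ψ₀, (hinv t ψ₀ hψ₀).1⟩))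
      (I * (inner ℂ (H ⟨unitaryGroup H t ψ₀, (hinv t ψ₀ hψ₀).2⟩)
              (A ⟨unitaryGroup H t ψ₀, (hinv t ψ₀ hψ₀).1⟩) -
            inner ℂ (A ⟨unitaryGroup H t ψ₀, (hinv t ψ₀ hψ₀).1⟩)
              (H ⟨unitaryGroup H t ψ₀, (hinv t ψ₀ hψ₀).2⟩))) t := by
  have hU := hH.isUnitaryGroupGeneratedBy_unitaryGroup
  obtain ⟨hAh, hAc⟩ : IsHermitean A ∧ A.IsClosed :=
    hA.elim (fun h => ⟨h.isHermitean, h.isClosed⟩) id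
  have hg := H.mem_graph ⟨ψ₀, hψ₀.2⟩
  have hHt (t : ℝ) : H ⟨unitaryGroup H t ψ₀, (hinv t ψ₀ hψ₀).2⟩ =
      unitaryGroup H t (H ⟨ψ₀, hψ₀.2⟩) :=
    H.mem_graph_snd_inj (H.mem_graph ⟨_, (hinv t ψ₀ hψ₀).2⟩) (hU.map_mem_graph hg t) rfl
  have hbound (t : ℝ) : ∃ C, ∀ᶠ s in 𝓝 t,
      ‖A ⟨unitaryGroup H s ψ₀, (hinv s ψ₀ hψ₀).1⟩‖ ≤ C := by
    obtain ⟨C, hC⟩ := hU.eventually_norm_le hAc hH.isClosed hinv hψ₀ t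
    exact ⟨C, hC.mono fun s hs => hs _ (A.mem_graph ⟨_, (hinv s ψ₀ hψ₀).1⟩)⟩
  have hderiv (t : ℝ) : HasDerivAt (fun t : ℝ =>
        inner ℂ (unitaryGroup H t ψ₀) (A ⟨unitaryGroup H t ψ₀, (hinv t ψ₀ hψ₀).1⟩))
      (I * (inner ℂ (H ⟨unitaryGroup H t ψ₀, (hinv t ψ₀ hψ₀).2⟩)
              (A ⟨unitaryGroup H t ψ₀, (hinv t ψ₀ hψ₀).1⟩) -
            inner ℂ (A ⟨unitaryGroup H t ψ₀, (hinv t ψ₀ hψ₀).1⟩)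
              (H ⟨unitaryGroup H t ψ₀, (hinv t ψ₀ hψ₀).2⟩))) t := by
    obtain ⟨C, hC⟩ := hbound t
    refine (hAh.hasDerivAt_inner hAc (fun t => (hinv t ψ₀ hψ₀).1) (hU.hasDerivAt hg t)
      hC).congr_deriv ?_
    rw [hHt, inner_neg_left, inner_neg_right, inner_smul_left, inner_smul_right, conj_I]
    ring
  refine ⟨contDiff_one_iff_deriv.2 ⟨fun t => (hderiv t).differentiableAt, ?_⟩, hderiv⟩
  rw [funext fun t => (hderiv t).deriv]
  -- Only weak continuity of `Aψ` is available; it suffices because `Hψ` is norm continuous.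
  have hcont : Continuous fun t : ℝ =>
      inner ℂ (A ⟨unitaryGroup H t ψ₀, (hinv t ψ₀ hψ₀).1⟩)
        (H ⟨unitaryGroup H t ψ₀, (hinv t ψ₀ hψ₀).2⟩) := by
    rw [continuous_iff_continuousAt]
    intro t
    obtain ⟨C, hC⟩ := hbound t
    refine hAc.tendsto_inner (fun s => A.mem_graph ⟨_, (hinv s ψ₀ hψ₀).1⟩)
      ((hU.continuous ψ₀).tendsto t) hC (A.mem_graph ⟨_, (hinv t ψ₀ hψ₀).1⟩) ?_
    simp_rw [hHt]
    exact (hU.continuous _).tendsto t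
  have hcont' := Complex.continuous_conj.comp hcont
  simp only [Function.comp_def, inner_conj_symm] at hcont'
  exact continuous_const.mul (hcont'.sub hcont)
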